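/- An $m\times n$ complex matrix $A$ ($m,n\ge 1$), with rows and columns indexed from $0$ and with $A[i,j]:=0$ for integers $i,j$ outside $0\le i<m$, $0\le j<n$, has aperiodic autocorrelation $R_A[\delta_1,\delta_2]=\sum_{i,j}A[i,j]\,\overline{A[i-\delta_1,j-\delta_2]}$ for $\delta_1,\delta_2\in\mathbb Z$, and weight $w(A)=\sum_{i,j}|A[i,j]|^2$. A quaternary Golay complementary matrix quad of size $m\times n$ consists of four $m\times n$ matrices $A_1,A_2,A_3,A_4$ with all entries in $\{1,-1,\mathrm{i},-\mathrm{i}\}$ such that $$\sum_{k=1}^{4}R_{A_k}[\delta_1,\delta_2]=\begin{cases}\sum_{k=1}^4 w(A_k)\;(=4mn), & (\delta_1,\delta_2)=(0,0),\\ 0, & \text{otherwise.}\end{cases}$$ For every integer $n$ with $1\le n\le 1000$, there is a positive integer $m$ for which a quaternary Golay complementary matrix quad of size $m\times n$ exists, and there is a positive integer $m$ for which one of size $n\times m$ exists. -/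

import Mathlib

namespace Golay

open scoped ComplexConjugate

/-- The entry `A[i, j]` of an `m × n` matrix, indexed from `[0, 0]`, extended by zero to all
integer indices outside `{0, …, m - 1} × {0, …, n - 1}`. -/
noncomputable def entry {m n : ℕ} (A : Matrix (Fin m) (Fin n) ℂ) (i j : ℤ) : ℂ :=
  if h : (0 ≤ i ∧ i < m) ∧ (0 ≤ j ∧ j < n) then
    A ⟨i.toNat, by omega⟩ ⟨j.toNat, by omega⟩
  else 0

/-- The aperiodic autocorrelation `R_A[δ₁, δ₂] = ∑ i, ∑ j, A[i, j] * conj A[i - δ₁, j - δ₂]`.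
It is defined for all integer shifts; it vanishes unless `|δ₁| < m` and `|δ₂| < n`. -/
noncomputable def autocorr {m n : ℕ} (A : Matrix (Fin m) (Fin n) ℂ) (δ₁ δ₂ : ℤ) : ℂ :=
  ∑ i : Fin m, ∑ j : Fin n,
    A i j * conj (entry A ((i : ℤ) - δ₁) ((j : ℤ) - δ₂))

/-- The weight `w(A) = ∑ i, ∑ j, |A[i, j]| ^ 2`. -/
noncomputable def weight {m n : ℕ} (A : Matrix (Fin m) (Fin n) ℂ) : ℝ :=
  ∑ i : Fin m, ∑ j : Fin n, ‖A i j‖ ^ 2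

/-- A Golay complementary matrix (GCM) set of `L` matrices of size `m × n`: the entries are
unimodular or zero, and the autocorrelations add up to the total weight times the unit pulse. -/
structure IsGCMSet {L m n : ℕ} (A : Fin L → Matrix (Fin m) (Fin n) ℂ) : Prop where
  unimodular_or_zero : ∀ k i j, ‖A k i j‖ = 1 ∨ A k i j = 0
  sum_autocorr : ∀ δ₁ δ₂ : ℤ,
    ∑ k, autocorr (A k) δ₁ δ₂ =
      if δ₁ = 0 ∧ δ₂ = 0 then ((∑ k, weight (A k) : ℝ) : ℂ) else 0

/-- A quaternary matrix: all entries lie in `{1, -1, I, -I}`. -/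
def IsQuaternary {m n : ℕ} (A : Matrix (Fin m) (Fin n) ℂ) : Prop :=
  ∀ i j, A i j ∈ ({1, -1, Complex.I, -Complex.I} : Set ℂ)

/-- `m × n` is the size of a quaternary GCM quad: `m` and `n` are positive and there are four
quaternary `m × n` matrices that form a GCM set. -/
def HasQuaternaryGCMQuad (m n : ℕ) : Prop :=
  0 < m ∧ 0 < n ∧
    ∃ A : Fin 4 → Matrix (Fin m) (Fin n) ℂ, (∀ k, IsQuaternary (A k)) ∧ IsGCMSet A

end Golay

/-!
An array is identified with its generating Laurent polynomial `P` in two variables. With `bar` for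
the involution that is complex conjugation on the torus, the autocorrelations of `P` are the
coefficients of `P * bar P`, so a quad is complementary if and only if `∑ P * bar P` is constant,
and constructions of quads become identities in a commutative ring.

The number of rows is free, and this makes pairs easy to multiply: if `A, B` is a Golay pair of
`m × n` arrays and `f, g` a quaternary Golay pair of sequences of length `s`, then stacking the two
parts of the product on top of each other, instead of superposing them, gives a quaternary Golay
pair of `2 m × s n` arrays (`HasPair.mul`). There are Golay pairs of sequences of lengths
2, 3, 5, 11 and 13, so every `{2, 3, 5, 11, 13}`-smooth `a` is the number of columns of a pair with
`2 ^ k` rows, for all large `k` (`isPairWidth_of_dvd`).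

Pairs with `m` rows and `a` and `b` columns, together with a Golay pair of sequences of length `s`,
give a quad with `m` rows and `(2 s + 1) (a + b)` columns by Yang's multiplication
(`HasPair.hasQuad`, resting on `yang_identity`). For `s = 0` this settles all sums of two smooth
numbers, hence all `1 < n ≤ 1000` except `799` and `959` (`exists_smooth_add_smooth`), and also
`1 = 1 + 0`, with a pair of empty arrays as the second summand. The two exceptions are
`17 * (45 + 2)` and `7 * (125 + 12)`, which are covered by `s = 8` and `s = 3`. Transposing the
matrices exchanges the roles of rows and columns.
-/

namespace Golay

open scoped ComplexConjugate
open AddMonoidAlgebra (single)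

/-! ### Laurent polynomials -/

/-- The ring of Laurent polynomials in two variables over `ℂ`. The exponents are the row and the
column index, so that an array is identified with its generating polynomial. -/
abbrev Laurent : Type := AddMonoidAlgebra ℂ (ℤ × ℤ)

/-- The involution of the Laurent polynomial ring that conjugates the coefficients and inverts both
variables; on the torus `|x| = |y| = 1` it is complex conjugation of the values. -/
noncomputable def bar : Laurent →+* Laurent :=
  (AddMonoidAlgebra.mapRingHom (ℤ × ℤ) (starRingEnd ℂ)).comp
    (AddMonoidAlgebra.mapDomainRingHom ℂ (negAddMonoidHom : ℤ × ℤ →+ ℤ × ℤ))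

/-- The monomial with row exponent `i` and column exponent `j`. -/
noncomputable def mono (i j : ℤ) : Laurent := single (i, j) 1

/-- The Laurent polynomials that are constant. -/
noncomputable def constants : Subring Laurent := (algebraMap ℂ Laurent).range

lemma bar_single (g : ℤ × ℤ) (c : ℂ) : bar (single g c) = single (-g) (conj c) := by
  simp [bar]

lemma bar_bar (P : Laurent) : bar (bar P) = P := by
  have h : bar.comp bar = RingHom.id Laurent := by
    ext <;> simp [bar_single]
  exact congrArg (fun φ : Laurent →+* Laurent => φ P) h

lemma coeff_bar (P : Laurent) (g : ℤ × ℤ) : (bar P).coeff g = conj (P.coeff (-g)) := by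
  have h := Finsupp.mapDomain_apply (neg_injective (G := ℤ × ℤ)) P.coeff (-g)
  rw [neg_neg] at h
  simp only [bar, RingHom.comp_apply, AddMonoidAlgebra.coeff_mapRingHom]
  congr 1

lemma bar_smul (c : ℂ) (P : Laurent) : bar (c • P) = conj c • bar P := by
  ext g
  simp [coeff_bar]

lemma bar_mono (i j : ℤ) : bar (mono i j) = mono (-i) (-j) := by
  simp [mono, bar_single]

lemma mono_mul_mono (i j k l : ℤ) : mono i j * mono k l = mono (i + k) (j + l) := by
  simp [mono]

lemma mono_zero : mono 0 0 = 1 := rfl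

lemma mono_mul_bar (i j : ℤ) : mono i j * bar (mono i j) = 1 := by
  rw [bar_mono, mono_mul_mono, add_neg_cancel, add_neg_cancel, mono_zero]

lemma mono_zero_pow (j : ℤ) (k : ℕ) : mono 0 j ^ k = mono 0 (k * j) := by
  induction k with
  | zero => simp [mono_zero]
  | succ k ih =>
    rw [pow_succ, ih, mono_mul_mono]
    push_cast
    ring_nf

lemma coeff_mono_mul (i j k l : ℤ) (P : Laurent) :
    (mono i j * P).coeff (k, l) = P.coeff (k - i, l - j) := by
  simp only [mono, AddMonoidAlgebra.coeff_single_mul_apply, one_mul]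
  congr 1
  ext <;> simp <;> ring

/-! ### Quaternary arrays -/

/-- The set of fourth roots of unity. -/
def quaternary : Set ℂ := {1, -1, Complex.I, -Complex.I}

lemma neg_mem_quaternary {c : ℂ} (hc : c ∈ quaternary) : -c ∈ quaternary := by
  rcases hc with rfl | rfl | rfl | rfl <;> simp [quaternary]

lemma conj_mem_quaternary {c : ℂ} (hc : c ∈ quaternary) : conj c ∈ quaternary := by
  rcases hc with rfl | rfl | rfl | rfl <;> simp [quaternary]

lemma mul_mem_quaternary {c d : ℂ} (hc : c ∈ quaternary) (hd : d ∈ quaternary) :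
    c * d ∈ quaternary := by
  rcases hc with rfl | rfl | rfl | rfl <;> rcases hd with rfl | rfl | rfl | rfl <;>
    simp [quaternary]

lemma norm_of_mem_quaternary {c : ℂ} (hc : c ∈ quaternary) : ‖c‖ = 1 := by
  rcases hc with rfl | rfl | rfl | rfl <;> simp

/-- `P` is the generating polynomial of a quaternary `m × n` array. The sizes `m = 0` and `n = 0`
are allowed; then `P = 0`. -/
structure IsArray (m n : ℕ) (P : Laurent) : Prop where
  mem : ∀ i j : ℤ, 0 ≤ i → i < m → 0 ≤ j → j < n → P.coeff (i, j) ∈ quaternary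
  eq_zero : ∀ i j : ℤ, ¬ ((0 ≤ i ∧ i < m) ∧ (0 ≤ j ∧ j < n)) → P.coeff (i, j) = 0

namespace IsArray

variable {m n a b : ℕ} {P Q : Laurent}

lemma zero_width (m : ℕ) : IsArray m 0 0 :=
  ⟨fun _ _ _ _ h h' => by omega, fun _ _ _ => rfl⟩

lemma one : IsArray 1 1 1 := by
  refine ⟨fun i j hi hi' hj hj' => ?_, fun i j h => ?_⟩
  · obtain rfl : i = 0 := by omega
    obtain rfl : j = 0 := by omega
    refine Or.inl ?_
    rw [AddMonoidAlgebra.one_def, AddMonoidAlgebra.coeff_single]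
    exact Finsupp.single_eq_same
  · have : ¬ ((0, 0) : ℤ × ℤ) = (i, j) := by
      rintro h'
      obtain ⟨rfl, rfl⟩ := Prod.mk.inj h'
      exact h (by simp)
    rw [AddMonoidAlgebra.one_def, AddMonoidAlgebra.coeff_single]
    exact Finsupp.single_eq_of_ne' this

lemma smul (hP : IsArray m n P) {c : ℂ} (hc : c ∈ quaternary) : IsArray m n (c • P) := by
  refine ⟨fun i j hi hi' hj hj' => ?_, fun i j h => ?_⟩
  · simpa using mul_mem_quaternary hc (hP.mem i j hi hi' hj hj')
  · simp [hP.eq_zero i j h]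

lemma neg (hP : IsArray m n P) : IsArray m n (-P) := by
  simpa using hP.smul (c := -1) (by simp [quaternary])

/-- Horizontal concatenation. -/
lemma hcat (hP : IsArray m a P) (hQ : IsArray m b Q) :
    IsArray m (a + b) (P + mono 0 a * Q) := by
  refine ⟨fun i j hi hi' hj hj' => ?_, fun i j h => ?_⟩
  · rw [AddMonoidAlgebra.coeff_add, Finsupp.add_apply, coeff_mono_mul]
    rcases lt_or_ge j a with hja | hja
    · rw [hQ.eq_zero _ _ (by omega), add_zero]
      exact hP.mem i j hi hi' hj hja
    · rw [hP.eq_zero _ _ (by omega), zero_add]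
      exact hQ.mem _ _ (by omega) (by omega) (by omega) (by push_cast at hj'; omega)
  · rw [AddMonoidAlgebra.coeff_add, Finsupp.add_apply, coeff_mono_mul,
      hP.eq_zero _ _ (by push_cast at h; omega), hQ.eq_zero _ _ (by push_cast at h; omega),
      add_zero]

/-- Vertical concatenation. -/
lemma vcat (hP : IsArray a n P) (hQ : IsArray b n Q) :
    IsArray (a + b) n (P + mono a 0 * Q) := by
  refine ⟨fun i j hi hi' hj hj' => ?_, fun i j h => ?_⟩
  · rw [AddMonoidAlgebra.coeff_add, Finsupp.add_apply, coeff_mono_mul]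
    rcases lt_or_ge i a with hja | hja
    · rw [hQ.eq_zero _ _ (by omega), add_zero]
      exact hP.mem i j hi hja hj hj'
    · rw [hP.eq_zero _ _ (by omega), zero_add]
      exact hQ.mem _ _ (by omega) (by push_cast at hi'; omega) (by omega) (by omega)
  · rw [AddMonoidAlgebra.coeff_add, Finsupp.add_apply, coeff_mono_mul,
      hP.eq_zero _ _ (by push_cast at h; omega), hQ.eq_zero _ _ (by push_cast at h; omega),
      add_zero]

/-- The conjugate of the array, read backwards in both directions. -/
lemma reverse (hP : IsArray m n P) : IsArray m n (mono (m - 1) (n - 1) * bar P) := by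
  refine ⟨fun i j hi hi' hj hj' => ?_, fun i j h => ?_⟩
  · rw [coeff_mono_mul, coeff_bar]
    exact conj_mem_quaternary
      (hP.mem _ _ (by dsimp; omega) (by dsimp; omega) (by dsimp; omega) (by dsimp; omega))
  · rw [coeff_mono_mul, coeff_bar, Prod.neg_mk, hP.eq_zero _ _ (by omega), map_zero]

/-- Horizontal concatenation of `s` blocks of equal width. -/
lemma hcat_blocks (s : ℕ) {B : ℕ → Laurent} (hB : ∀ k < s, IsArray m n (B k)) :
    IsArray m (s * n) (∑ k ∈ Finset.range s, mono 0 n ^ k * B k) := by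
  induction s with
  | zero => simpa using zero_width m
  | succ s ih =>
    rw [Finset.sum_range_succ, add_mul, one_mul, mono_zero_pow]
    simpa using (ih fun k hk => hB k (by omega)).hcat (hB s (by omega))

end IsArray

/-! ### Golay pairs of sequences -/

/-- The polynomial in `X` with coefficient sequence `f 0, …, f (s - 1)`. -/
noncomputable def seqEval (s : ℕ) (f : ℕ → ℂ) (X : Laurent) : Laurent :=
  ∑ k ∈ Finset.range s, f k • X ^ k

/-- The sequences `f 0, …, f (s - 1)` and `g 0, …, g (s - 1)` form a quaternary Golay pair. The
complementarity is stated through values at an arbitrary unit `X` with inverse `Y`, which is how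
it is used. The values at indices `≥ s` play no role in it; asking that they are quaternary as well
avoids side conditions. -/
structure IsSeqPair (s : ℕ) (f g : ℕ → ℂ) : Prop where
  left_mem : ∀ k, f k ∈ quaternary
  right_mem : ∀ k, g k ∈ quaternary
  complementary : ∀ X Y : Laurent, X * Y = 1 →
    seqEval s f X * seqEval s (fun k => conj (f k)) Y +
      seqEval s g X * seqEval s (fun k => conj (g k)) Y = 2 * s

lemma bar_seqEval (s : ℕ) (f : ℕ → ℂ) (X : Laurent) :
    bar (seqEval s f X) = seqEval s (fun k => conj (f k)) (bar X) := by
  simp [seqEval, bar_smul]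

/-- Multiplying the value at `X⁻¹` by `X ^ (s - 1)` reverses the sequence. Here `Y` stands for `X⁻¹`
and `V` for `X ^ (s - 1)`, whose exponent is the integer `-1` if `s = 0`. -/
lemma seqEval_reverse (s : ℕ) (f : ℕ → ℂ) (X Y V : Laurent) (hXY : X * Y = 1)
    (hV : V * X = X ^ s) :
    V * seqEval s f Y = seqEval s (fun k => f (s - 1 - k)) X := by
  rw [seqEval, seqEval, ← Finset.sum_range_reflect, Finset.mul_sum]
  refine Finset.sum_congr rfl fun k hk => ?_
  have hk := Finset.mem_range.1 hk
  have h1 : X ^ (s - 1 - k) * Y ^ (s - 1 - k) = 1 := by rw [← mul_pow, hXY, one_pow]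
  have h2 : V = X ^ (s - 1) := by
    have : X ^ s = X ^ (s - 1) * X := by rw [← pow_succ]; congr 1; omega
    linear_combination Y * hV - V * hXY + X ^ (s - 1) * hXY + Y * this
  have h3 : X ^ (s - 1) = X ^ k * X ^ (s - 1 - k) := by rw [← pow_add]; congr 1; omega
  rw [mul_smul_comm, h2, h3, mul_assoc, h1, mul_one]

lemma seqEval_mul (s : ℕ) (f : ℕ → ℂ) (X A : Laurent) :
    seqEval s f X * A = ∑ k ∈ Finset.range s, X ^ k * (f k • A) := by
  rw [seqEval, Finset.sum_mul]
  exact Finset.sum_congr rfl fun k _ => by rw [smul_mul_assoc, mul_smul_comm]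

/-- The quaternary sequence whose exponents to the base `I` are listed. -/
noncomputable def ofExponents (l : List ℕ) (k : ℕ) : ℂ := Complex.I ^ l.getD k 0

lemma ofExponents_mem (l : List ℕ) (k : ℕ) : ofExponents l k ∈ quaternary := by
  have h : ∀ e : ℕ, Complex.I ^ e ∈ quaternary := fun e => by
    induction e with
    | zero => simp [quaternary]
    | succ e ih => exact pow_succ Complex.I e ▸ mul_mem_quaternary ih (by simp [quaternary])
  exact h _

/-- For two sequences to form a Golay pair, it suffices that an identity between polynomials in
`X` without negative powers holds, in which `J` is the imaginary unit. -/
lemma isSeqPair_ofExponents (s : ℕ) (l l' : List ℕ)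
    (h : ∀ X J : Laurent, J ^ 2 = -1 →
      (∑ k ∈ Finset.range (s + 1), J ^ l.getD k 0 * X ^ k) *
          (∑ k ∈ Finset.range (s + 1), (-J) ^ l.getD (s - k) 0 * X ^ k) +
        (∑ k ∈ Finset.range (s + 1), J ^ l'.getD k 0 * X ^ k) *
          (∑ k ∈ Finset.range (s + 1), (-J) ^ l'.getD (s - k) 0 * X ^ k) =
        2 * (s + 1) * X ^ s) :
    IsSeqPair (s + 1) (ofExponents l) (ofExponents l') := by
  refine ⟨ofExponents_mem l, ofExponents_mem l', fun X Y hXY => ?_⟩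
  have hJ : algebraMap ℂ Laurent Complex.I ^ 2 = -1 := by
    rw [← map_pow, Complex.I_sq, map_neg, map_one]
  have hr : ∀ f : ℕ → ℂ, X ^ s * seqEval (s + 1) f Y = seqEval (s + 1) (fun k => f (s - k)) X :=
    fun f => seqEval_reverse (s + 1) f X Y (X ^ s) hXY (pow_succ X s).symm
  have h' := h X _ hJ
  have e1 : ∀ l : List ℕ, seqEval (s + 1) (ofExponents l) X =
      ∑ k ∈ Finset.range (s + 1), algebraMap ℂ Laurent Complex.I ^ l.getD k 0 * X ^ k :=
    fun l => Finset.sum_congr rfl fun k _ => by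
      simp only [Algebra.smul_def, ofExponents, map_pow]
  have e2 : ∀ l : List ℕ, seqEval (s + 1) (fun k => conj (ofExponents l (s - k))) X =
      ∑ k ∈ Finset.range (s + 1), (-algebraMap ℂ Laurent Complex.I) ^ l.getD (s - k) 0 * X ^ k :=
    fun l => Finset.sum_congr rfl fun k _ => by
      simp only [Algebra.smul_def, ofExponents, map_pow, Complex.conj_I, map_neg]
  rw [← e1, ← e1, ← e2, ← e2, ← hr fun k => conj (ofExponents l k),
    ← hr fun k => conj (ofExponents l' k)] at h'
  have hp : X ^ s * Y ^ s = 1 := by rw [← mul_pow, hXY, one_pow]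
  push_cast
  linear_combination Y ^ s * h' - (seqEval (s + 1) (ofExponents l) X *
    seqEval (s + 1) (fun k => conj (ofExponents l k)) Y + seqEval (s + 1) (ofExponents l') X *
    seqEval (s + 1) (fun k => conj (ofExponents l' k)) Y - 2 * (s + 1)) * hp

lemma isSeqPair_zero : IsSeqPair 0 (ofExponents []) (ofExponents []) :=
  ⟨ofExponents_mem _, ofExponents_mem _, fun X Y _ => by simp [seqEval]⟩

lemma isSeqPair_one : IsSeqPair 1 (ofExponents [0]) (ofExponents [0]) := by
  refine isSeqPair_ofExponents 0 _ _ fun X J hJ => ?_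
  simp
  ring

lemma isSeqPair_two : IsSeqPair 2 (ofExponents [0, 2]) (ofExponents [0, 0]) := by
  refine isSeqPair_ofExponents 1 _ _ fun X J hJ => ?_
  simp [Finset.sum_range_succ]
  grind

lemma isSeqPair_three : IsSeqPair 3 (ofExponents [0, 0, 2]) (ofExponents [0, 1, 0]) := by
  refine isSeqPair_ofExponents 2 _ _ fun X J hJ => ?_
  simp [Finset.sum_range_succ]
  grind

lemma isSeqPair_five :
    IsSeqPair 5 (ofExponents [0, 2, 1, 1, 1]) (ofExponents [0, 1, 2, 0, 3]) := by
  refine isSeqPair_ofExponents 4 _ _ fun X J hJ => ?_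
  simp [Finset.sum_range_succ]
  grind

lemma isSeqPair_eight :
    IsSeqPair 8 (ofExponents [0, 1, 3, 0, 3, 2, 0, 3])
      (ofExponents [0, 3, 3, 2, 3, 0, 0, 1]) := by
  refine isSeqPair_ofExponents 7 _ _ fun X J hJ => ?_
  simp [Finset.sum_range_succ]
  grind

lemma isSeqPair_eleven :
    IsSeqPair 11 (ofExponents [0, 0, 0, 1, 2, 0, 1, 3, 1, 0, 2])
      (ofExponents [0, 1, 2, 2, 2, 1, 1, 0, 3, 1, 0]) := by
  refine isSeqPair_ofExponents 10 _ _ fun X J hJ => ?_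
  simp [Finset.sum_range_succ]
  grind

lemma isSeqPair_thirteen :
    IsSeqPair 13 (ofExponents [0, 2, 1, 3, 1, 2, 1, 1, 3, 0, 1, 1, 1])
      (ofExponents [0, 1, 2, 2, 2, 1, 2, 0, 0, 3, 2, 0, 3]) := by
  refine isSeqPair_ofExponents 12 _ _ fun X J hJ => ?_
  simp [Finset.sum_range_succ]
  grind

/-! ### Pairs of arrays -/

/-- There is a quaternary Golay pair of `m × n` arrays, possibly empty. -/
def HasPair (m n : ℕ) : Prop :=
  ∃ A B : Laurent, IsArray m n A ∧ IsArray m n B ∧ A * bar A + B * bar B ∈ constants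

lemma hasPair_one_one : HasPair 1 1 :=
  ⟨1, 1, .one, .one, by simpa using add_mem (one_mem constants) (one_mem constants)⟩

/-- There are pairs of empty arrays. -/
lemma hasPair_zero (m : ℕ) : HasPair m 0 :=
  ⟨0, 0, .zero_width m, .zero_width m, by simp [zero_mem]⟩

/-- Stacking the two halves of the product vertically leaves them with disjoint supports, so the
product is quaternary although `f` and `g` need not be real. -/
lemma HasPair.mul {m n s : ℕ} {f g : ℕ → ℂ} (h : HasPair m n) (hfg : IsSeqPair s f g) :
    HasPair (2 * m) (s * n) := by
  obtain ⟨A, B, hA, hB, hAB⟩ := h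
  have key : ∀ {f g : ℕ → ℂ} {A B : Laurent}, (∀ k, f k ∈ quaternary) → (∀ k, g k ∈ quaternary) →
      IsArray m n A → IsArray m n B → IsArray (2 * m) (s * n)
        (seqEval s f (mono 0 n) * A + mono m 0 * (seqEval s g (mono 0 n) * B)) := by
    intro f g A B hf hg hA hB
    rw [seqEval_mul, seqEval_mul, two_mul]
    exact (IsArray.hcat_blocks s fun k _ => hA.smul (hf k)).vcat
      (IsArray.hcat_blocks s fun k _ => hB.smul (hg k))
  refine ⟨_, _, key hfg.left_mem hfg.right_mem hA hB,
    key hfg.left_mem hfg.right_mem hB.reverse hA.reverse.neg, ?_⟩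
  have hZ := mono_mul_bar m 0
  have hV := mono_mul_bar (m - 1) (n - 1)
  have hFG := hfg.complementary _ _ (mono_mul_bar 0 n)
  rw [← bar_seqEval, ← bar_seqEval] at hFG
  have hc : (2 * s : Laurent) ∈ constants := mul_mem (ofNat_mem _ 2) (natCast_mem _ s)
  have := mul_mem hc hAB
  rw [← hFG] at this
  convert this using 1
  simp only [map_add, map_mul, map_neg, bar_bar]
  generalize mono m 0 = Z at *
  generalize mono (m - 1) (n - 1) = V at *
  generalize seqEval s f (mono 0 n) = F at *
  generalize seqEval s g (mono 0 n) = G at *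
  linear_combination (G * bar G * (A * bar A + B * bar B)) * hZ +
    ((F * bar B - Z * G * bar A) * (bar F * B - bar Z * bar G * A)) * hV

/-- The numbers `n` for which there are pairs with `n` columns and any large power of two as the
number of rows. -/
def IsPairWidth (n : ℕ) : Prop := ∃ K, ∀ k ≥ K, HasPair (2 ^ k) n

lemma IsPairWidth.mul {n s : ℕ} {f g : ℕ → ℂ} (h : IsPairWidth n) (hfg : IsSeqPair s f g) :
    IsPairWidth (s * n) := by
  obtain ⟨K, hK⟩ := h
  refine ⟨K + 1, fun k hk => ?_⟩
  obtain ⟨k, rfl⟩ := Nat.exists_eq_add_of_le' (show 1 ≤ k by omega)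
  rw [pow_succ']
  exact (hK k (by omega)).mul hfg

/-! ### Quads of arrays -/

/-- There is a quaternary Golay quad of `m × n` arrays, given by generating polynomials; empty
arrays are allowed. -/
def HasQuad (m n : ℕ) : Prop :=
  ∃ P : Fin 4 → Laurent, (∀ k, IsArray m n (P k)) ∧ ∑ k, P k * bar (P k) ∈ constants

/-- The identity behind the quad construction, in an arbitrary commutative ring; the primed
variables play the role of complex conjugates. The cross terms without `p` cancel between `Q` and
`S` and between `W` and `T`; those with `p` reduce to `p' (A D V G' - B C G)` and its conjugate, in
`Q, W` with one sign and in `S, T` with the other. -/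
lemma yang_identity {R : Type*} [CommRing R]
    {A A' B B' C C' D D' F F' G G' U U' V V' p p' Q Q' S S' T T' W W' : R}
    (hU : U * U' = 1) (hV : V * V' = 1) (hp : p * p' = 1)
    (hQ : Q = A * F + C * G + p * B') (hQ' : Q' = A' * F' + C' * G' + p' * B)
    (hW : W = B * F + D * (V * G') - p * A') (hW' : W' = B' * F' + D' * (V' * G) - p' * A)
    (hS : S = U * (A * (V * G') - C * (V * F') + p * D'))
    (hS' : S' = U' * (A' * (V' * G) - C' * (V' * F) + p' * D))
    (hT : T = U * (B * G - D * (V * F') - p * C'))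
    (hT' : T' = U' * (B' * G' - D' * (V' * F) - p' * C)) :
    Q * Q' + W * W' + S * S' + T * T' =
      (F * F' + G * G' + 1) * ((A * A' + B * B') + (C * C' + D * D')) := by
  subst_vars
  linear_combination
    ((A * (V * G') - C * (V * F') + p * D') * (A' * (V' * G) - C' * (V' * F) + p' * D) +
      (B * G - D * (V * F') - p * C') * (B' * G' - D' * (V' * F) - p' * C)) * hU +
    ((A * G' - C * F') * (A' * G - C' * F) + D * D' * (F * F' + G * G')) * hV +
    (A * A' + B * B' + C * C' + D * D') * hp

/-- The layout of the arrays in Yang's multiplication: `s` groups of four blocks, of widths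
`a, b, a, b`, and then two blocks of widths `a, b`. -/
lemma isArray_yang {m a b s : ℕ} {f g h e : ℕ → ℂ} {A C B D : Laurent}
    (hf : ∀ k, f k ∈ quaternary) (hg : ∀ k, g k ∈ quaternary) (hh : ∀ k, h k ∈ quaternary)
    (he : ∀ k, e k ∈ quaternary) (hA : IsArray m a A) (hC : IsArray m b C) (hB : IsArray m a B)
    (hD : IsArray m b D) :
    IsArray m ((2 * s + 1) * (a + b))
      (seqEval s f (mono 0 (2 * (a + b))) * A +
          seqEval s g (mono 0 (2 * (a + b))) * (mono 0 a * C) +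
        mono 0 (a + b) * (seqEval s h (mono 0 (2 * (a + b))) * A +
          seqEval s e (mono 0 (2 * (a + b))) * (mono 0 a * C)) +
        mono 0 (s * (2 * (a + b))) * (B + mono 0 a * D)) := by
  have hblock := IsArray.hcat_blocks s fun k _ =>
    ((hA.smul (hf k)).hcat (hC.smul (hg k))).hcat ((hA.smul (hh k)).hcat (hC.smul (he k)))
  convert hblock.hcat (hB.hcat hD) using 1
  · ring
  · simp only [seqEval_mul, Finset.mul_sum, ← Finset.sum_add_distrib]
    push_cast
    rw [← two_mul ((a : ℤ) + b)]
    congr 1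
    refine Finset.sum_congr rfl fun k _ => ?_
    simp only [Algebra.smul_def]
    ring

/-- Yang's multiplication: pairs with `a` and with `b` columns are combined along a Golay pair of
sequences of length `s`. For `s = 0` this is concatenation, up to reversal. -/
theorem HasPair.hasQuad {m a b s : ℕ} {f g : ℕ → ℂ} (ha : HasPair m a) (hb : HasPair m b)
    (hfg : IsSeqPair s f g) : HasQuad m ((2 * s + 1) * (a + b)) := by
  obtain ⟨A, B, hA, hB, hAB⟩ := ha
  obtain ⟨C, D, hC, hD, hCD⟩ := hb
  set t : ℤ := a + b with ht
  set X := mono 0 (2 * t) with hX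
  set V := mono 0 (((s : ℤ) - 1) * (2 * t)) with hV
  set f' : ℕ → ℂ := fun k => conj (f (s - 1 - k)) with hf'
  set g' : ℕ → ℂ := fun k => conj (g (s - 1 - k)) with hg'
  have mf : ∀ k, f' k ∈ quaternary := fun k => conj_mem_quaternary (hfg.left_mem _)
  have mg : ∀ k, g' k ∈ quaternary := fun k => conj_mem_quaternary (hfg.right_mem _)
  have mn : ∀ {h : ℕ → ℂ}, (∀ k, h k ∈ quaternary) → ∀ k, (-h) k ∈ quaternary :=
    fun h k => neg_mem_quaternary (h k)
  have hneg : ∀ h : ℕ → ℂ, seqEval s (-h) X = -seqEval s h X := fun h => by simp [seqEval]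
  have hVX : V * X = X ^ s := by
    rw [hV, hX, mono_mul_mono, mono_zero_pow]
    ring_nf
  have hrev : ∀ h : ℕ → ℂ, seqEval s (fun k => conj (h (s - 1 - k))) X =
      V * bar (seqEval s h X) := fun h => by
    rw [bar_seqEval]
    exact (seqEval_reverse s (fun k => conj (h k)) X (bar X) V (mono_mul_bar _ _) hVX).symm
  set F := seqEval s f X with hF
  set G := seqEval s g X with hG
  set W := mono 0 (a : ℤ) with hW
  set U := mono 0 t with hU
  -- `p` moves `bar B` onto the block of `a` columns that follows the `s` groups
  set p := mono ((m : ℤ) - 1) (s * (2 * t) + (a - 1)) with hp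
  have hWW : W * bar W = 1 := mono_mul_bar _ _
  have hUU : U * bar U = 1 := mono_mul_bar _ _
  have hVV : V * bar V = 1 := mono_mul_bar _ _
  have hpp : p * bar p = 1 := mono_mul_bar _ _
  have hpa : p = mono 0 (s * (2 * t)) * mono (m - 1) (a - 1) := by
    rw [mono_mul_mono, hp]; ring_nf
  have hpb : U * p * bar W = mono 0 (s * (2 * t)) * (W * mono (m - 1) (b - 1)) := by
    rw [hW, hU, hp, bar_mono]
    simp only [mono_mul_mono]
    rw [ht]
    ring_nf
  set Q := A * F + W * C * G + p * bar B with hQ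
  set R := B * F + W * D * (V * bar G) - p * bar A with hR
  set S := U * (A * (V * bar G) - W * C * (V * bar F) + p * bar (W * D)) with hS
  set T := U * (B * G - W * D * (V * bar F) - p * bar (W * C)) with hT
  have key : Q * bar Q + R * bar R + S * bar S + T * bar T ∈ constants := by
    rw [yang_identity hUU hVV hpp hQ
      (by simp only [hQ, map_add, map_mul, bar_bar]) hR
      (by simp only [hR, map_add, map_sub, map_mul, bar_bar]) hS
      (by simp only [hS, map_add, map_sub, map_mul, bar_bar]) hT
      (by simp only [hT, map_sub, map_mul, bar_bar])]
    refine mul_mem (add_mem ?_ (one_mem _)) (add_mem hAB ?_)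
    · rw [bar_seqEval, bar_seqEval, hfg.complementary _ _ (mono_mul_bar _ _)]
      exact mul_mem (ofNat_mem _ 2) (natCast_mem _ s)
    · convert hCD using 1
      simp only [map_mul]
      linear_combination (C * bar C + D * bar D) * hWW
  -- `Q` and `R` have the same support, and `S` and `T` have the complementary one
  refine ⟨![Q + S, Q - S, R + T, R - T], ?_, ?_⟩
  · intro k
    fin_cases k
    · convert isArray_yang hfg.left_mem hfg.right_mem mg (mn mf) hA hC hB.reverse hD.reverse using 1
      simp only [← ht, ← hX, ← hW, ← hU, ← hF, ← hG, hneg, hf', hg', hrev]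
      simp only [Fin.zero_eta, Matrix.cons_val_zero, hQ, hS, map_mul]
      linear_combination bar B * hpa + bar D * hpb
    · convert isArray_yang hfg.left_mem hfg.right_mem (mn mg) mf hA hC hB.reverse hD.reverse.neg
        using 1
      simp only [← ht, ← hX, ← hW, ← hU, ← hF, ← hG, hneg, hf', hg', hrev]
      simp only [Fin.mk_one, Matrix.cons_val_one, Matrix.cons_val_zero, hQ, hS, map_mul]
      linear_combination bar B * hpa - bar D * hpb
    · convert isArray_yang hfg.left_mem mg hfg.right_mem (mn mf) hB hD hA.reverse.neg
        hC.reverse.neg using 1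
      simp only [← ht, ← hX, ← hW, ← hU, ← hF, ← hG, hneg, hf', hg', hrev]
      simp only [Fin.reduceFinMk, Matrix.cons_val, hR, hT, map_mul]
      linear_combination -bar A * hpa - bar C * hpb
    · convert isArray_yang hfg.left_mem mg (mn hfg.right_mem) mf hB hD hA.reverse.neg
        hC.reverse using 1
      simp only [← ht, ← hX, ← hW, ← hU, ← hF, ← hG, hneg, hf', hg', hrev]
      simp only [Fin.reduceFinMk, Matrix.cons_val, hR, hT, map_mul]
      linear_combination -bar A * hpa + bar C * hpb
  · convert mul_mem (ofNat_mem constants 2) key using 1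
    simp only [Fin.sum_univ_four, Matrix.cons_val, map_add, map_sub]
    ring

/-! ### From Laurent polynomials to matrices -/

/-- The matrix of coefficients of a Laurent polynomial. -/
noncomputable def toMatrix (m n : ℕ) (P : Laurent) : Matrix (Fin m) (Fin n) ℂ :=
  fun i j => P.coeff ((i : ℤ), (j : ℤ))

lemma IsArray.entry_toMatrix {m n : ℕ} {P : Laurent} (hP : IsArray m n P) (i j : ℤ) :
    entry (toMatrix m n P) i j = P.coeff (i, j) := by
  unfold entry
  split_ifs with h
  · simp [toMatrix, h.1.1, h.2.1]
  · exact (hP.eq_zero i j h).symm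

lemma IsArray.eq_sum_single {m n : ℕ} {P : Laurent} (hP : IsArray m n P) :
    P = ∑ i : Fin m, ∑ j : Fin n, single ((i : ℤ), (j : ℤ)) (P.coeff ((i : ℤ), (j : ℤ))) := by
  ext ⟨i, j⟩
  simp only [AddMonoidAlgebra.coeff_sum, Finsupp.finsetSum_apply, AddMonoidAlgebra.coeff_single,
    Finsupp.single_apply, Prod.mk.injEq]
  by_cases h : (0 ≤ i ∧ i < m) ∧ (0 ≤ j ∧ j < n)
  · obtain ⟨⟨hi, hi'⟩, hj, hj'⟩ := h
    lift i to ℕ using hi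
    lift j to ℕ using hj
    rw [Finset.sum_eq_single ⟨i, by omega⟩, Finset.sum_eq_single ⟨j, by omega⟩]
    · simp
    · intro j' _ hne
      exact if_neg fun h => hne (Fin.ext (by have := h.2; dsimp; omega))
    · simp
    · intro i' _ hne
      exact Finset.sum_eq_zero fun j' _ =>
        if_neg fun h => hne (Fin.ext (by have := h.1; dsimp; omega))
    · simp
  · rw [hP.eq_zero i j h]
    refine (Finset.sum_eq_zero fun i' _ =>
      Finset.sum_eq_zero fun j' _ => if_neg fun h' => h ?_).symm
    omega

/-- The autocorrelations of an array are the coefficients of `P * bar P`. -/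
lemma IsArray.autocorr_toMatrix {m n : ℕ} {P : Laurent} (hP : IsArray m n P) (δ₁ δ₂ : ℤ) :
    autocorr (toMatrix m n P) δ₁ δ₂ = (P * bar P).coeff (δ₁, δ₂) := by
  conv_rhs => enter [1, 1, 1]; rw [hP.eq_sum_single]
  simp only [Finset.sum_mul, AddMonoidAlgebra.coeff_sum, Finsupp.finsetSum_apply,
    AddMonoidAlgebra.coeff_single_mul_apply, coeff_bar]
  refine Finset.sum_congr rfl fun i _ => Finset.sum_congr rfl fun j _ => ?_
  have h : -(-((i : ℤ), (j : ℤ)) + (δ₁, δ₂)) = ((i : ℤ) - δ₁, (j : ℤ) - δ₂) := by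
    ext <;> simp <;> ring
  rw [hP.entry_toMatrix, h]
  rfl

lemma autocorr_zero {m n : ℕ} (A : Matrix (Fin m) (Fin n) ℂ) : autocorr A 0 0 = weight A := by
  simp [autocorr, weight, entry, Complex.mul_conj']

lemma autocorr_transpose {m n : ℕ} (A : Matrix (Fin m) (Fin n) ℂ) (δ₁ δ₂ : ℤ) :
    autocorr A.transpose δ₁ δ₂ = autocorr A δ₂ δ₁ := by
  have h : ∀ i j, entry A.transpose i j = entry A j i := fun i j => by
    simp only [entry, Matrix.transpose_apply, and_comm]
  rw [autocorr, autocorr, Finset.sum_comm]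
  simp only [h, Matrix.transpose_apply]

lemma HasQuad.hasQuaternaryGCMQuad {m n : ℕ} (hm : 0 < m) (hn : 0 < n) (h : HasQuad m n) :
    HasQuaternaryGCMQuad m n := by
  obtain ⟨P, hP, hc⟩ := h
  have hq : ∀ k, IsQuaternary (toMatrix m n (P k)) := fun k i j =>
    (hP k).mem _ _ (by omega) (by omega) (by omega) (by omega)
  refine ⟨hm, hn, fun k => toMatrix m n (P k), hq,
    fun k i j => Or.inl (norm_of_mem_quaternary (hq k i j)), fun δ₁ δ₂ => ?_⟩
  split_ifs with hδ
  · rw [hδ.1, hδ.2]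
    push_cast
    exact Finset.sum_congr rfl fun k _ => autocorr_zero _
  · obtain ⟨c, hc⟩ := hc
    simp only [(hP _).autocorr_toMatrix]
    rw [← Finsupp.finsetSum_apply, ← AddMonoidAlgebra.coeff_sum, ← hc]
    refine Finsupp.single_eq_of_ne' fun h => hδ ?_
    obtain ⟨rfl, rfl⟩ := Prod.mk.inj h
    exact ⟨rfl, rfl⟩

lemma HasQuaternaryGCMQuad.transpose {m n : ℕ} (h : HasQuaternaryGCMQuad m n) :
    HasQuaternaryGCMQuad n m := by
  obtain ⟨hm, hn, A, hq, hu, hs⟩ := h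
  refine ⟨hn, hm, fun k => (A k).transpose, fun k i j => hq k j i, fun k i j => hu k j i,
    fun δ₁ δ₂ => ?_⟩
  have hw : ∀ k, weight (A k).transpose = weight (A k) := fun k => Finset.sum_comm
  simp only [autocorr_transpose, hs, hw, and_comm]

/-! ### The widths up to 1000 -/

lemma isPairWidth_of_dvd {n : ℕ} (h : n ∣ 2 ^ 9 * 3 ^ 6 * 5 ^ 4 * 11 ^ 2 * 13 ^ 2) :
    IsPairWidth n := by
  induction n using induction_on_primes with
  | zero => norm_num at h
  | one =>
    refine ⟨0, fun k _ => ?_⟩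
    have h : ∀ k, HasPair (2 ^ k) 1 := fun k => by
      induction k with
      | zero => exact hasPair_one_one
      | succ k ih =>
        rw [pow_succ']
        exact ih.mul isSeqPair_one
    exact h k
  | prime_mul p n hp ih =>
    have hn := ih ((dvd_mul_left n p).trans h)
    have hpd := (dvd_mul_right p n).trans h
    simp only [hp.dvd_mul] at hpd
    rcases hpd with (((h | h) | h) | h) | h
    · rw [(Nat.prime_dvd_prime_iff_eq hp Nat.prime_two).1 (hp.dvd_of_dvd_pow h)]
      exact hn.mul isSeqPair_two
    · rw [(Nat.prime_dvd_prime_iff_eq hp Nat.prime_three).1 (hp.dvd_of_dvd_pow h)]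
      exact hn.mul isSeqPair_three
    · rw [(Nat.prime_dvd_prime_iff_eq hp Nat.prime_five).1 (hp.dvd_of_dvd_pow h)]
      exact hn.mul isSeqPair_five
    · rw [(Nat.prime_dvd_prime_iff_eq hp (by norm_num)).1 (hp.dvd_of_dvd_pow h)]
      exact hn.mul isSeqPair_eleven
    · rw [(Nat.prime_dvd_prime_iff_eq hp (by norm_num)).1 (hp.dvd_of_dvd_pow h)]
      exact hn.mul isSeqPair_thirteen

lemma IsPairWidth.exists_hasQuad {a b s : ℕ} {f g : ℕ → ℂ} (ha : IsPairWidth a)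
    (hb : IsPairWidth b) (hfg : IsSeqPair s f g) :
    ∃ m, 0 < m ∧ HasQuad m ((2 * s + 1) * (a + b)) := by
  obtain ⟨K, hK⟩ := ha
  obtain ⟨K', hK'⟩ := hb
  exact ⟨2 ^ max K K', by positivity,
    (hK _ (le_max_left _ _)).hasQuad (hK' _ (le_max_right _ _)) hfg⟩

/-- From 2 to 1000, all numbers but two are sums of two `{2, 3, 5, 11, 13}`-smooth numbers. The
exponents in the modulus are the largest that occur below 1000. -/
lemma exists_smooth_add_smooth {n : ℕ} (h1 : 1 < n) (h2 : n ≤ 1000) (h799 : n ≠ 799)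
    (h959 : n ≠ 959) : ∃ a ≤ n, a ∣ 2 ^ 9 * 3 ^ 6 * 5 ^ 4 * 11 ^ 2 * 13 ^ 2 ∧
      n - a ∣ 2 ^ 9 * 3 ^ 6 * 5 ^ 4 * 11 ^ 2 * 13 ^ 2 := by
  have hK : 2 ^ 9 * 3 ^ 6 * 5 ^ 4 * 11 ^ 2 * 13 ^ 2 = 4770342720000 := by norm_num
  -- neither `a = 0` nor `n - a = 0` passes the test, because `K % 0 = K`
  have check : (List.range' 2 999).all (fun n => n.beq 799 || n.beq 959 ||
      (List.range 170).any fun a =>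
        (4770342720000 % a).beq 0 && (4770342720000 % (n - a)).beq 0) = true := by
    decide +kernel
  have h := List.all_eq_true.1 check n (by rw [List.mem_range'_1]; omega)
  simp only [Nat.beq_eq, Bool.or_eq_true, h799, h959, false_or, List.any_eq_true,
    Bool.and_eq_true] at h
  obtain ⟨a, -, ha, hb⟩ := h
  rw [hK]
  have hd := Nat.dvd_of_mod_eq_zero hb
  refine ⟨a, ?_, Nat.dvd_of_mod_eq_zero ha, hd⟩
  by_contra hlt
  rw [Nat.sub_eq_zero_of_le (by omega)] at hd
  norm_num at hd

lemma exists_hasQuad {n : ℕ} (h1 : 1 ≤ n) (h2 : n ≤ 1000) : ∃ m, 0 < m ∧ HasQuad m n := by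
  rcases h1.eq_or_lt with rfl | h1
  · have h : IsPairWidth 1 := isPairWidth_of_dvd (by norm_num)
    have h0 : IsPairWidth 0 := ⟨0, fun k _ => hasPair_zero _⟩
    exact h.exists_hasQuad h0 isSeqPair_zero
  by_cases h799 : n = 799
  -- `799 = (2 * 8 + 1) * (45 + 2)`
  · subst h799
    have h : IsPairWidth 45 := isPairWidth_of_dvd (by norm_num)
    have h' : IsPairWidth 2 := isPairWidth_of_dvd (by norm_num)
    exact h.exists_hasQuad h' isSeqPair_eight
  by_cases h959 : n = 959
  -- `959 = (2 * 3 + 1) * (125 + 12)`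
  · subst h959
    have h : IsPairWidth 125 := isPairWidth_of_dvd (by norm_num)
    have h' : IsPairWidth 12 := isPairWidth_of_dvd (by norm_num)
    exact h.exists_hasQuad h' isSeqPair_three
  obtain ⟨a, ha, hd, hd'⟩ := exists_smooth_add_smooth h1 h2 h799 h959
  have := (isPairWidth_of_dvd hd).exists_hasQuad (isPairWidth_of_dvd hd') isSeqPair_zero
  rwa [mul_zero, zero_add, one_mul, Nat.add_sub_cancel' ha] at this

end Golay

theorem mainTheorem5 :
    ∀ n : ℕ, 1 ≤ n → n ≤ 1000 →
      (∃ m : ℕ, Golay.HasQuaternaryGCMQuad m n) ∧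
        (∃ m : ℕ, Golay.HasQuaternaryGCMQuad n m) := by
  intro n h1 h2
  obtain ⟨m, hm, h⟩ := Golay.exists_hasQuad h1 h2
  have h := h.hasQuaternaryGCMQuad hm h1
  exact ⟨⟨m, h⟩, ⟨m, h.transpose⟩⟩
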